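/- Let $n\ge 2$ and let $\sigma=(\lambda_1,\dots,\lambda_n)$ be a list of complex numbers with power sums $s_k=\lambda_1^k+\cdots+\lambda_n^k$ for $k\ge 1$. Suppose that (i) $\lambda_1$ is real and $\lambda_1>|\lambda_j|$ for all $j>1$; (ii) all $s_k$ are real, $s_1\ge 0$, and $s_k>0$ for all $k\ge 2$. Write $$f(x)=\prod_{i=1}^n(x-\lambda_i)=x^n+p_1x^{n-1}+\cdots+p_n ,$$ and put $$\gamma=2\max\bigl(1,|p_1|,|p_2|^{1/2},\dots,|p_n|^{1/n}\bigr),\qquad \lambda_0=\max\{|\lambda_j|:j>1\},$$ $$R=\frac{\lambda_1-\lambda_0}{4},\qquad \ell=\frac{3\lambda_1+\lambda_0}{\lambda_1+3\lambda_0},\qquad r=\min(R,1),\qquad m=\max(1,\lambda_1),$$ $$N_0=\left\lceil\frac{\ln(2n-2)}{\ln \ell}\right\rceil,\qquad M=\min\{1,s_2,\dots,s_{N_0}\}\quad(M=1\text{ if }N_0=1),$$ $$N=\left\lceil 2\left(\frac{16\,\gamma\, n\, N_0\,(m+r)^{N_0-1}}{\sqrt3\, M\, r}\right)^{n}\right\rceil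 .$$ Then $N\ge n$. Let $$J_N(f)(x)=x^n+\sum_{i=1}^n\frac{N^{i-1}}{(N-1)(N-2)\cdots(N-i+1)}\,p_i\,x^{n-i},$$ where the empty product in the denominator for $i=1$ is $1$; define $\mu_1,\dots,\mu_n\in\mathbb C$ (unique up to order) by $J_N(f)(x)=\prod_{i=1}^n(x-N\mu_i)$, and let $x_k=\mu_1^k+\cdots+\mu_n^k$ for $k=1,\dots,N$. Let $X_N$ be the $N\times N$ matrix with entries $$(X_N)_{ij}=x_{i-j+1}\ (j\le i),\qquad (X_N)_{i,i+1}=i,\qquad (X_N)_{ij}=0\ (j>i+1),$$ that is, $$X_N=\begin{pmatrix}x_1&1&0&\cdots&0\\ x_2&x_1&2&\cdots&0\\ \vdots&\vdots&\ddots&\ddots&\vdots\\ x_{N-1}&x_{N-2}&\cdots&x_1&N-1\\ x_N&x_{N-1}&\cdots&x_2&x_1\end{pmatrix}.$$ Then all entries of $X_N$ are real and nonnegative, and the spectrum of $X_N$, counted with multiplicities, is $\sigma$ with $N-n$ zeros added: $(\lambda_1,\dots,\lambda_n,0,\dots,0)$. -/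

import Mathlib

open Polynomial
open scoped ComplexOrder

noncomputable section

namespace BoyleHandelman

/-- The power sum `z_1 ^ k + ... + z_n ^ k` of a list of complex numbers. -/
def powerSum {n : ℕ} (z : Fin n → ℂ) (k : ℕ) : ℂ := ∑ i, z i ^ k

/-- The `N × N` patterned matrix
`x_1  1    0    ...  0`,
`x_2  x_1  2    ...  0`,
`x_3  x_2  x_1  ...  0`,
`...             N-1`,
`x_N  x_{N-1}  ...  x_1`.
Rows and columns are numbered from `0` here. -/
def newtonMatrix (N : ℕ) (x : ℕ → ℂ) : Matrix (Fin N) (Fin N) ℂ :=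
  Matrix.of fun i j =>
    if (j : ℕ) ≤ (i : ℕ) then x ((i : ℕ) - (j : ℕ) + 1)
    else if (j : ℕ) = (i : ℕ) + 1 then ((i : ℕ) : ℂ) + 1
    else 0

/-- For a monic polynomial `f = x ^ n + p_1 x ^ (n-1) + ... + p_n`, the polynomial
`x ^ n + ∑_{i=1}^{n} N ^ (i-1) / ((N-1)(N-2)...(N-i+1)) p_i x ^ (n-i)`. -/
def J (N : ℕ) (f : ℂ[X]) : ℂ[X] :=
  X ^ f.natDegree + ∑ i ∈ Finset.Icc 1 f.natDegree,
    C ((N : ℂ) ^ (i - 1) / (∏ j ∈ Finset.Icc 1 (i - 1), ((N : ℂ) - (j : ℂ)))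
      * f.coeff (f.natDegree - i)) * X ^ (f.natDegree - i)

section Constants

variable {n : ℕ}

/-- `f = (x - λ_1) ... (x - λ_n)`. -/
def listPoly (lam : Fin n → ℂ) : ℂ[X] := ∏ i, (X - C (lam i))

/-- `p_i`, the coefficient of `x ^ (n-i)` in `f`. -/
def listCoeff (lam : Fin n → ℂ) (i : ℕ) : ℂ := (listPoly lam).coeff (n - i)

/-- `γ = 2 max (1, |p_1|, |p_2| ^ (1/2), ..., |p_n| ^ (1/n))`. -/
def gam (lam : Fin n → ℂ) : ℝ :=
  2 * (Finset.Icc 1 n).fold max 1 fun i => ‖listCoeff lam i‖ ^ (1 / (i : ℝ))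

variable [NeZero n]

/-- `λ_0 = max {|λ_j| : j > 1}`. The first entry of the list has index `0` here, and the starting
value `0` of the maximum does not matter as soon as `n ≥ 2`. -/
def lamZero (lam : Fin n → ℂ) : ℝ :=
  (Finset.univ.erase (0 : Fin n)).fold max 0 fun j => ‖lam j‖

/-- The first entry `λ_1` of the list, as a real number. -/
def lamOne (lam : Fin n → ℂ) : ℝ := (lam 0).re

/-- `R = (λ_1 - λ_0) / 4`. -/
def gapR (lam : Fin n → ℂ) : ℝ := (lamOne lam - lamZero lam) / 4

/-- `ℓ = (3 λ_1 + λ_0) / (λ_1 + 3 λ_0)`. -/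
def ell (lam : Fin n → ℂ) : ℝ :=
  (3 * lamOne lam + lamZero lam) / (lamOne lam + 3 * lamZero lam)

/-- `r = min (R, 1)`. -/
def smallR (lam : Fin n → ℂ) : ℝ := min (gapR lam) 1

/-- `m = max {1, λ_1}`. -/
def bigm (lam : Fin n → ℂ) : ℝ := max 1 (lamOne lam)

/-- `N_0 = ⌈ln (2n - 2) / ln ℓ⌉`. -/
def NZero (lam : Fin n → ℂ) : ℕ := ⌈Real.log (2 * (n : ℝ) - 2) / Real.log (ell lam)⌉₊

/-- `M = min {1, s_2, ..., s_{N_0}}`. -/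
def minM (lam : Fin n → ℂ) : ℝ :=
  (Finset.Icc 2 (NZero lam)).fold min 1 fun k => (powerSum lam k).re

/-- `N = ⌈2 (16 γ n N_0 (m + r) ^ (N_0 - 1) / (3 ^ (1/2) M r)) ^ n⌉`. -/
def bigN (lam : Fin n → ℂ) : ℕ :=
  ⌈2 * ((16 * gam lam * (n : ℝ) * (NZero lam : ℝ) *
      (bigm lam + smallR lam) ^ (NZero lam - 1)) /
    (Real.sqrt 3 * minM lam * smallR lam)) ^ n⌉₊

end Constants

end BoyleHandelman

end

/-!
The spectrum of the patterned matrix is read off a power series, and the signs of its entries follow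
from a perturbation bound for the zeros of a polynomial.

*Spectrum.* For `z : Fin n → ℂ` put `Q(t) = ∏ (1 - z i t)`, with coefficients `revCoeff z`, and
`G(t) = Q(t) exp(x t)`. Newton's identities say `Q' = -S Q`, where `S` is the generating series of
the power sums, so that `G' = x G - S G`. Comparing coefficients, the vector `(G_0, ..., G_{N-1})`
is mapped by `x - X_N` to `N G_N` times the last basis vector. As `x - X_N` is lower Hessenberg and
`G_0 = 1`, this gives `det (x - X_N) = N! G_N` (`eval_charpoly_newtonMatrix`), a polynomial in `x`
with coefficients `N! / (N - i)!` times those of `Q`. The operator `J_N` is the inverse of this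
modification of coefficients, up to the scaling by `N`, whence the characteristic polynomial is
`x ^ (N - n) f(x)` (`charpoly_newtonMatrix_of_J_eq`).

*Matching of zeros.* Let `f` and `g` be monic of degree `n`, and suppose `|f| ≤ ε` at all zeros of
the polynomials on the segment from `f` to `g`. Following the zeros along the segment in small
steps (their continuity comes from compactness) joins each zero of `f` to a zero of `g` by
arbitrarily fine chains inside `{|f| ≤ ε}`. Projected to the line through its end points at
distance `d`, these chains come arbitrarily close to every point of an interval of length `d`, and
projecting the zeros of `f` as well only decreases `|f|`. Chebyshev's lower bound
`2 (d / 4) ^ n` for the maximum of a monic polynomial on that interval gives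
`d ≤ 4 (ε / 2) ^ (1 / n)` (`exists_perm_norm_sub_le`). It is essential that the constant does not
depend on `n`.

*Signs.* For `g = J_N(f)` all these zeros lie in `|x| ≤ γ`, and there `ε = 4 γ ^ n / N` works
(`norm_le_of_segment_root`). By the choice of `N` the zeros of `f` and `J_N(f)` can be matched
within `rootDist`, which is so small that the power sums of exponent `2 ≤ k ≤ N_0` change by less
than `M`. For `k ≥ N_0` the zero of `J_N(f)` near `λ_1` is real and dominates the others, the ratio
of the bounds being `ℓ` with `ℓ ^ k ≥ 2 n - 2` (`powerSum_pos_of_close`).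
-/

open Polynomial
open scoped ComplexOrder

noncomputable section

namespace BoyleHandelman

/-! ### Newton's identities and the characteristic polynomial of the patterned matrix -/

/-- The coefficient of `t ^ k` in `∏ (1 - z i t)`, which is the coefficient of `x ^ (n - k)` in
`listPoly z` if `k ≤ n`, and `0` if `k > n`. -/
def revCoeff {n : ℕ} (z : Fin n → ℂ) (k : ℕ) : ℂ :=
  (-1) ^ k * (Finset.univ.val.map z).esymm k

section Newton
variable {n : ℕ} (z : Fin n → ℂ)

lemma revCoeff_zero : revCoeff z 0 = 1 := by
  simp [revCoeff, Multiset.esymm]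

lemma revCoeff_of_lt {k : ℕ} (hk : n < k) : revCoeff z k = 0 := by
  have : Multiset.powersetCard k (Finset.univ.val.map z) = 0 :=
    Multiset.powersetCard_eq_empty k (by simpa using hk)
  rw [revCoeff, Multiset.esymm, this]; simp

lemma coeff_listPoly {i : ℕ} (hi : i ≤ n) :
    (listPoly z).coeff (n - i) = revCoeff z i := by
  have h := Multiset.prod_X_sub_C_coeff (Finset.univ.val.map z) (k := n - i) (by simp)
  rw [Multiset.map_map] at h
  have h2 : Multiset.card (Finset.univ.val.map z) - (n - i) = i := by
    simp only [Multiset.card_map, Finset.card_val, Finset.card_univ, Fintype.card_fin]; omega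
  rw [h2] at h
  exact h

/-- Newton's identities, in the form `Q' = -S Q` with `Q` the power series of coefficients
`revCoeff z` and `S` the generating series of the power sums. -/
lemma newton_revCoeff (k : ℕ) :
    ((k : ℂ) + 1) * revCoeff z (k + 1) =
      -∑ a ∈ Finset.HasAntidiagonal.antidiagonal k, revCoeff z a.1 * powerSum z (a.2 + 1) := by
  have h := congrArg (MvPolynomial.aeval z) (MvPolynomial.mul_esymm_eq_sum (Fin n) ℂ (k + 1))
  simp only [map_mul, map_natCast, map_pow, map_neg, map_one, map_sum,
    MvPolynomial.aeval_esymm_eq_multiset_esymm, MvPolynomial.psum, MvPolynomial.aeval_X] at h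
  have hfil : Finset.filter (fun a : ℕ × ℕ => a.1 < k + 1)
        (Finset.HasAntidiagonal.antidiagonal (k + 1)) =
      (Finset.HasAntidiagonal.antidiagonal k).map
        ((Function.Embedding.refl ℕ).prodMap ⟨Nat.succ, Nat.succ_injective⟩) := by
    rw [Finset.Nat.antidiagonal_succ']
    ext ⟨a, b⟩
    simp only [Finset.mem_filter, Finset.mem_cons, Finset.mem_map, Prod.mk.injEq]
    constructor
    · rintro ⟨h | h, h2⟩
      · omega
      · exact h
    · rintro ⟨⟨c, d⟩, h1, h2⟩
      refine ⟨Or.inr ⟨⟨c, d⟩, h1, h2⟩, ?_⟩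
      simp at h1 h2
      omega
  rw [hfil, Finset.sum_map] at h
  simp only [revCoeff, powerSum]
  have h3 : ((k : ℂ) + 1) * ((-1) ^ (k + 1) * (Finset.univ.val.map z).esymm (k + 1)) =
    (-1) ^ (k + 1) * (((k + 1 : ℕ) : ℂ) * (Finset.univ.val.map z).esymm (k + 1)) := by
    push_cast; ring
  rw [h3, h, ← mul_assoc, ← mul_pow_sub_one (n := k + 1 + 1) (by omega), Nat.add_sub_cancel]
  have h4 : ((-1 : ℂ) ^ (k + 1)) * (-1 * (-1) ^ (k + 1)) = -1 := by
    rw [mul_left_comm, ← mul_pow]; simp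
  rw [h4, neg_one_mul]
  rfl

/-- The coefficients of the power series `∏ (1 - z i t) * exp (x t)`. -/
def expCoeff (x : ℂ) (k : ℕ) : ℂ :=
  ∑ a ∈ Finset.HasAntidiagonal.antidiagonal k, revCoeff z a.1 * (x ^ a.2 / (a.2.factorial : ℂ))

/-- The differential equation `G' = x G - S G` of `G = Q exp (x t)`, in coefficients. -/
lemma expCoeff_succ (x : ℂ) (k : ℕ) :
    ((k : ℂ) + 1) * expCoeff z x (k + 1) = x * expCoeff z x k -
      ∑ a ∈ Finset.HasAntidiagonal.antidiagonal k, expCoeff z x a.1 * powerSum z (a.2 + 1) := by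
  let P : PowerSeries ℂ := PowerSeries.mk (revCoeff z)
  let E : PowerSeries ℂ := PowerSeries.mk fun b => x ^ b / (b.factorial : ℂ)
  let S : PowerSeries ℂ := PowerSeries.mk fun b => powerSum z (b + 1)
  have hP : PowerSeries.derivative ℂ P = -(P * S) := by
    ext k
    simp only [PowerSeries.coeff_derivative, P, S, PowerSeries.coeff_mk, map_neg,
      PowerSeries.coeff_mul]
    rw [mul_comm, newton_revCoeff]
  have hE : PowerSeries.derivative ℂ E = PowerSeries.C x * E := by
    ext k
    simp only [PowerSeries.coeff_derivative, E, PowerSeries.coeff_mk, PowerSeries.coeff_C_mul]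
    have : ((k.factorial : ℕ) : ℂ) ≠ 0 := by exact_mod_cast k.factorial_ne_zero
    have : (k : ℂ) + 1 ≠ 0 := by exact_mod_cast k.succ_ne_zero
    rw [Nat.factorial_succ]
    push_cast
    field_simp
    ring
  have hG (k : ℕ) : PowerSeries.coeff k (P * E) = expCoeff z x k := by
    simp only [PowerSeries.coeff_mul, P, E, expCoeff, PowerSeries.coeff_mk]
  have hd : PowerSeries.derivative ℂ (P * E) = PowerSeries.C x * (P * E) - (P * E) * S := by
    rw [Derivation.leibniz, hP, hE, smul_eq_mul, smul_eq_mul]; ring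
  have := congrArg (PowerSeries.coeff k) hd
  rw [PowerSeries.coeff_derivative, hG, map_sub, PowerSeries.coeff_C_mul, hG,
    PowerSeries.coeff_mul] at this
  simp only [hG, S, PowerSeries.coeff_mk] at this
  rw [mul_comm, this]

end Newton

open Matrix in
/-- If a lower Hessenberg matrix maps a vector with first entry `1` to a multiple `w` of the last
basis vector, then its determinant is `w` times the product of the negated superdiagonal. -/
lemma det_of_hessenberg_mulVec {R : Type*} [CommRing R] {M : ℕ}
    (A : Matrix (Fin (M + 1)) (Fin (M + 1)) R)
    (hA : ∀ i j : Fin (M + 1), (i : ℕ) + 1 < j → A i j = 0) (u : Fin (M + 1) → R) (hu : u 0 = 1)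
    (w : R) (hw : A *ᵥ u = Pi.single (Fin.last M) w) :
    A.det = w * ∏ i : Fin M, -A i.castSucc i.succ := by
  have h := Matrix.det_updateCol_sum A 0 u
  rw [hu, one_smul] at h
  have h1 : (fun k => ∑ i, u i • A k i) = Pi.single (Fin.last M) w := by
    rw [← hw]; ext k; simp [Matrix.mulVec, dotProduct, mul_comm]
  rw [← h, h1, Matrix.det_succ_column_zero, Finset.sum_eq_single (Fin.last M)]
  · have h2 : (A.updateCol 0 (Pi.single (Fin.last M) w)).submatrix (Fin.last M).succAbove Fin.succ =
        A.submatrix Fin.castSucc Fin.succ := by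
      ext i j; simp
    rw [h2, Matrix.det_of_isLowerTriangular]
    · simp only [Fin.val_last, updateCol_self, Pi.single_eq_same, submatrix_apply]
      rw [Finset.prod_neg]
      simp
      ring
    · intro i j hij
      apply hA
      have : i < j := hij
      simp; omega
  · intro b _ hb
    simp [hb]
  · simp

open Matrix in
/-- The characteristic polynomial of the patterned matrix of power sums: the vector of the
coefficients of `∏ (1 - z i t) * exp (x t)` is mapped to a multiple of the last basis vector by
`x - X_N`, which is the differential equation satisfied by that power series. -/
lemma eval_charpoly_newtonMatrix {n : ℕ} (z : Fin n → ℂ) (N : ℕ) (hN : N ≠ 0) (x : ℂ) :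
    (newtonMatrix N (powerSum z)).charpoly.eval x = N.factorial * expCoeff z x N := by
  obtain ⟨M, rfl⟩ := Nat.exists_eq_succ_of_ne_zero hN
  rw [Matrix.eval_charpoly]
  have key (i : Fin (M + 1)) : ∑ j : Fin (M + 1), newtonMatrix (M + 1) (powerSum z) i j *
      expCoeff z x j = x * expCoeff z x i - if i = Fin.last M then
        ((M : ℂ) + 1) * expCoeff z x (M + 1) else 0 := by
    have h1 : ∑ j : Fin (M + 1), newtonMatrix (M + 1) (powerSum z) i j * expCoeff z x j =
        ∑ j ∈ Finset.range (M + 1), (if j ≤ (i : ℕ) then powerSum z ((i : ℕ) - j + 1)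
          else if j = (i : ℕ) + 1 then ((i : ℕ) : ℂ) + 1 else 0) * expCoeff z x j :=
      Fin.sum_univ_eq_sum_range (fun j => (if j ≤ (i : ℕ) then powerSum z ((i : ℕ) - j + 1)
          else if j = (i : ℕ) + 1 then ((i : ℕ) : ℂ) + 1 else 0) * expCoeff z x j) (M + 1)
    have h2 : ∑ j ∈ Finset.range ((i : ℕ) + 1), powerSum z ((i : ℕ) - j + 1) * expCoeff z x j =
        x * expCoeff z x i - ((i : ℂ) + 1) * expCoeff z x (i + 1) := by
      rw [expCoeff_succ, Finset.Nat.sum_antidiagonal_eq_sum_range_succ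
        (fun a b => expCoeff z x a * powerSum z (b + 1))]
      rw [sub_sub_cancel]
      exact Finset.sum_congr rfl fun _ _ => mul_comm _ _
    have h3 : ∑ j ∈ Finset.range ((i : ℕ) + 1), powerSum z ((i : ℕ) - j + 1) * expCoeff z x j =
        ∑ j ∈ Finset.range ((i : ℕ) + 1), (if j ≤ (i : ℕ) then powerSum z ((i : ℕ) - j + 1)
          else if j = (i : ℕ) + 1 then ((i : ℕ) : ℂ) + 1 else 0) * expCoeff z x j := by
      refine Finset.sum_congr rfl fun j hj => ?_
      rw [if_pos (by simp at hj; omega)]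
    rw [h1]
    rcases eq_or_ne i (Fin.last M) with rfl | hi
    · rw [Fin.val_last] at *
      rw [if_pos rfl, ← h3, h2]
    · have hi' : (i : ℕ) < M := Fin.val_lt_last hi
      rw [if_neg hi, sub_zero, ← Finset.sum_subset (Finset.range_mono
        (show (i : ℕ) + 1 + 1 ≤ M + 1 by omega)), Finset.sum_range_succ, ← h3, h2]
      · simp
      · intro j _ hj
        simp only [Finset.mem_range] at hj
        rw [if_neg (by omega), if_neg (by omega), zero_mul]
  rw [det_of_hessenberg_mulVec _ ?_ (fun j => expCoeff z x j) ?_ (((M : ℂ) + 1) *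
    expCoeff z x (M + 1)) ?_]
  · have : ∏ i : Fin M, -(Matrix.scalar (Fin (M + 1)) x - newtonMatrix (M + 1) (powerSum z))
        i.castSucc i.succ = (M.factorial : ℂ) := by
      rw [← Finset.prod_range_add_one_eq_factorial]
      push_cast
      rw [← Fin.prod_univ_eq_prod_range (fun i => (i : ℂ) + 1)]
      refine Finset.prod_congr rfl fun i _ => ?_
      have : i.castSucc ≠ i.succ := Fin.castSucc_lt_succ.ne
      simp [newtonMatrix, this]
    rw [this, Nat.factorial_succ]
    push_cast
    ring
  · intro i j hij
    have h1 : i ≠ j := by rintro rfl; omega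
    simp only [Matrix.sub_apply, Matrix.scalar_apply, Matrix.diagonal_apply_ne _ h1, newtonMatrix,
      Matrix.of_apply]
    rw [if_neg (by omega), if_neg (by omega), sub_zero]
  · simp [expCoeff, revCoeff_zero]
  · ext i
    rw [Matrix.sub_mulVec, Pi.sub_apply]
    have h4 : (newtonMatrix (M + 1) (powerSum z) *ᵥ fun j => expCoeff z x j) i = _ := key i
    rw [h4]
    simp [Pi.single_apply, Matrix.mulVec_diagonal]

/-! ### Chebyshev's bound and chains in a lemniscate -/

/-- Chebyshev's lower bound: a monic real polynomial of degree `n` with `n` real zeros takes a value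
of modulus at least `2 (d / 4) ^ n` on the interval `[0, d]`. -/
lemma two_mul_pow_le_of_forall_Icc_abs_prod_le {n : ℕ} (hn : n ≠ 0) (a : Fin n → ℝ) {d ε : ℝ}
    (hd : 0 ≤ d) (hε : 0 < ε) (h : ∀ x ∈ Set.Icc 0 d, |∏ i, (x - a i)| ≤ ε) :
    2 * (d / 4) ^ n ≤ ε := by
  -- the polynomial `ε⁻¹ ∏ (x - a i)` with the interval `[0, d]` rescaled to `[-1, 1]`
  let P : ℝ[X] := C ε⁻¹ * ∏ i, (C (d / 2) * X + C (d / 2 - a i))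
  have hlin (i : Fin n) : (C (d / 2) * X + C (d / 2 - a i) : ℝ[X]).natDegree ≤ 1 :=
    natDegree_linear_le
  have hdeg : (∏ i, (C (d / 2) * X + C (d / 2 - a i)) : ℝ[X]).natDegree ≤ n := by
    refine (natDegree_prod_le _ _).trans ((Finset.sum_le_sum fun i _ => hlin i).trans ?_)
    simp
  have hcoeff : P.coeff n = ε⁻¹ * (d / 2) ^ n := by
    have := coeff_prod_of_natDegree_le (s := Finset.univ)
      (fun i : Fin n => (C (d / 2) * X + C (d / 2 - a i) : ℝ[X])) 1 (fun i _ => hlin i)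
    simp only [Finset.card_univ, Fintype.card_fin, mul_one] at this
    simp only [P, coeff_C_mul, this]
    simp [coeff_C, div_pow]
  have h1 : P.coeff n ≤ 2 ^ (n - 1) := by
    refine Chebyshev.coeff_le_of_forall_abs_le_one ?_ ?_
    · refine natDegree_le_iff_degree_le.mp ((natDegree_C_mul_le _ _).trans hdeg)
    · intro y hy
      have hx := h (d / 2 * y + d / 2) ⟨by nlinarith [hy.1], by nlinarith [hy.2]⟩
      simp only [P, eval_mul, eval_C, eval_prod, eval_add, eval_X]
      rw [abs_mul, abs_of_pos (inv_pos.mpr hε), inv_mul_le_iff₀ hε, mul_one]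
      refine le_of_eq_of_le (congrArg _ (Finset.prod_congr rfl fun i _ => ?_)) hx
      ring
  rw [hcoeff, inv_mul_le_iff₀ hε] at h1
  obtain ⟨k, rfl⟩ := Nat.exists_eq_succ_of_ne_zero hn
  have h2 : (d / 4) ^ (k + 1) = (d / 2) ^ (k + 1) / 2 ^ (k + 1) := by
    rw [← div_pow]; congr 1; ring
  rw [Nat.succ_eq_add_one] at *
  rw [h2, mul_div_assoc', div_le_iff₀ (by positivity), pow_succ 2 k]
  simp only [Nat.add_sub_cancel] at h1
  linarith

/-- Discrete intermediate value theorem: a chain of reals with steps at most `δ` comes within `δ` of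
every point between its end points. -/
lemma exists_chain_near {K : ℕ} {y : ℕ → ℝ} {δ : ℝ} (hδ : 0 ≤ δ)
    (hy : ∀ j < K, |y (j + 1) - y j| ≤ δ) {x : ℝ} (h0 : y 0 ≤ x) (hK : x ≤ y K) :
    ∃ j ≤ K, |y j - x| ≤ δ := by
  induction K with
  | zero => exact ⟨0, le_rfl, by rw [le_antisymm h0 hK]; simpa using hδ⟩
  | succ K ih =>
    by_cases h : x ≤ y K
    · obtain ⟨j, hj, h'⟩ := ih (fun j hj => hy j (by omega)) h
      exact ⟨j, by omega, h'⟩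
    · refine ⟨K, by omega, ?_⟩
      have := abs_le.mp (hy K (by omega))
      rw [abs_le]
      constructor <;> linarith

/-- Two points at distance more than `D`, where `ε ≤ 2 (D / 4) ^ n`, are not joined by arbitrarily
fine chains inside the lemniscate `∏ |x - lam i| ≤ ε`: some `δ > 0` is such that every chain with
steps at most `δ` leaves it. -/
lemma exists_chain_scale {n : ℕ} (hn : n ≠ 0) (lam : Fin n → ℂ) {ε D : ℝ} (hε : 0 < ε) (hD : 0 ≤ D)
    (hDε : ε ≤ 2 * (D / 4) ^ n) (a b : ℂ) (hab : D < ‖a - b‖) :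
    ∃ δ > 0, ∀ (K : ℕ) (z : ℕ → ℂ), z 0 = a → z K = b → (∀ j < K, ‖z (j + 1) - z j‖ ≤ δ) →
      ∃ j ≤ K, ε < ‖∏ i, (z j - lam i)‖ := by
  set d := ‖a - b‖ with hd
  have hd0 : 0 < d := hD.trans_lt hab
  -- the projection onto the line from `a` to `b`
  let ρ : ℂ → ℝ := fun z => ((z - a) * (starRingEnd ℂ (b - a) / d)).re
  have hu : ‖starRingEnd ℂ (b - a) / (d : ℂ)‖ = 1 := by
    rw [norm_div, Complex.norm_conj, Complex.norm_real, norm_sub_rev, ← hd,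
      Real.norm_of_nonneg hd0.le, div_self hd0.ne']
  have hρ (z w : ℂ) : |ρ z - ρ w| ≤ ‖z - w‖ := by
    simp only [ρ]
    rw [← Complex.sub_re, ← sub_mul, sub_sub_sub_cancel_right]
    refine (Complex.abs_re_le_norm _).trans ?_
    rw [norm_mul, hu, mul_one]
  have hρa : ρ a = 0 := by simp [ρ]
  have hρb : ρ b = d := by
    simp only [ρ]
    rw [mul_div_assoc', Complex.mul_conj, Complex.normSq_eq_norm_sq, norm_sub_rev, ← hd,
      ← Complex.ofReal_div, Complex.ofReal_re]
    field_simp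
  obtain ⟨x, hx, hxε⟩ : ∃ x ∈ Set.Icc 0 d, ε < |∏ i, (x - ρ (lam i))| := by
    by_contra! hcon
    have := two_mul_pow_le_of_forall_Icc_abs_prod_le hn _ hd0.le hε hcon
    have h2 : 2 * (D / 4) ^ n < 2 * (d / 4) ^ n := by gcongr
    linarith
  have hcont : Continuous fun x : ℝ => |∏ i, (x - ρ (lam i))| := by fun_prop
  obtain ⟨δ, hδ, hball⟩ :=
    Metric.eventually_nhds_iff.mp (hcont.continuousAt.eventually_const_lt hxε)
  refine ⟨δ / 2, by positivity, fun K z h0 hK hz => ?_⟩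
  obtain ⟨j, hj, hjx⟩ := exists_chain_near (y := fun j => ρ (z j)) (x := x) (δ := δ / 2) (K := K)
    (by positivity) (fun j hj => (hρ _ _).trans (hz j hj)) (by simp [h0, hρa, hx.1])
    (by simp [hK, hρb, hx.2])
  refine ⟨j, hj, (hball (y := ρ (z j)) ?_).trans_le ?_⟩
  · rw [Real.dist_eq]; linarith
  · rw [Finset.abs_prod, norm_prod]
    exact Finset.prod_le_prod (fun _ _ => abs_nonneg _) fun i _ => hρ _ _

/-! ### Matching the zeros of two polynomials -/

section Matching
variable {n : ℕ}

lemma listPoly_monic (z : Fin n → ℂ) : (listPoly z).Monic :=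
  monic_prod_of_monic _ _ fun _ _ => monic_X_sub_C _

lemma natDegree_listPoly (z : Fin n → ℂ) : (listPoly z).natDegree = n := by
  simp [listPoly]

lemma eval_listPoly (z : Fin n → ℂ) (x : ℂ) : (listPoly z).eval x = ∏ i, (x - z i) := by
  simp [listPoly, eval_prod]

lemma roots_listPoly (z : Fin n → ℂ) : (listPoly z).roots = Finset.univ.val.map z :=
  roots_multiset_prod_X_sub_C (Finset.univ.val.map z) ▸ by
    rw [Multiset.map_map]; rfl

lemma exists_listPoly_eq {p : ℂ[X]} (hp : p.Monic) (hdeg : p.natDegree = n) :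
    ∃ z : Fin n → ℂ, listPoly z = p := by
  have hs := IsAlgClosed.splits p
  have hcard : p.roots.toList.length = n := by
    rw [Multiset.length_toList, ← hdeg]; exact splits_iff_card_roots.mp hs
  refine ⟨fun i => p.roots.toList.get (i.cast hcard.symm), ?_⟩
  conv_rhs => rw [hs.eq_prod_roots_of_monic hp, ← Multiset.coe_toList p.roots]
  subst hcard
  simp only [listPoly, Fin.cast_eq_self, Multiset.map_coe, Multiset.prod_coe]
  rw [← List.prod_ofFn]
  exact congrArg List.prod (List.ofFn_getElem_eq_map p.roots.toList fun x => X - C x)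

lemma exists_perm_of_listPoly_eq {z w : Fin n → ℂ} (h : listPoly z = listPoly w) :
    ∃ σ : Equiv.Perm (Fin n), ∀ i, z i = w (σ i) := by
  have h1 : Finset.univ.val.map z = Finset.univ.val.map w := by
    rw [← roots_listPoly, ← roots_listPoly, h]
  have h2 (c : ℂ) : Nonempty ({i // z i = c} ≃ {i // w i = c}) := by
    rw [← Fintype.card_eq, Fintype.card_subtype, Fintype.card_subtype]
    have := congrArg (Multiset.count c) h1
    simp only [Multiset.count_map] at this
    simpa only [Finset.card_def, Finset.filter_val, eq_comm] using this
  exact ⟨Equiv.ofFiberEquiv fun c => (h2 c).some, fun i => (Equiv.ofFiberEquiv_map _ i).symm⟩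

lemma ext_of_revCoeff_eq {z w : Fin n → ℂ} (h : ∀ k ≤ n, revCoeff z k = revCoeff w k) :
    listPoly z = listPoly w := by
  ext k
  rcases le_or_gt k n with hk | hk
  · obtain ⟨i, hi, rfl⟩ : ∃ i ≤ n, k = n - i := ⟨n - k, by omega, by omega⟩
    rw [coeff_listPoly z hi, coeff_listPoly w hi, h i hi]
  · rw [coeff_eq_zero_of_natDegree_lt, coeff_eq_zero_of_natDegree_lt] <;>
      rwa [natDegree_listPoly]

/-- The `ℓ¹` distance of the coefficient vectors of `listPoly z` and `listPoly w`. -/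
def coeffDist (z w : Fin n → ℂ) : ℝ :=
  ∑ k ∈ Finset.range (n + 1), ‖revCoeff z k - revCoeff w k‖

lemma continuous_revCoeff (k : ℕ) : Continuous fun z : Fin n → ℂ => revCoeff z k := by
  simp only [revCoeff, Finset.esymm_map_val]
  fun_prop

/-- Uniform continuity of the zeros as functions of the coefficients, for zeros in a fixed disc. The
pairs of lists that cannot be matched within `δ` form a compact set, on which `coeffDist` has no
zero. -/
lemma exists_forall_coeffDist_lt (ρ : ℝ) {δ : ℝ} (hδ : 0 < δ) :
    ∃ η > 0, ∀ z w : Fin n → ℂ, (∀ i, ‖z i‖ ≤ ρ) → (∀ i, ‖w i‖ ≤ ρ) → coeffDist z w < η →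
      ∃ σ : Equiv.Perm (Fin n), ∀ i, ‖w (σ i) - z i‖ ≤ δ := by
  let S : Set ((Fin n → ℂ) × (Fin n → ℂ)) :=
    ((Set.univ.pi fun _ => Metric.closedBall 0 ρ) ×ˢ (Set.univ.pi fun _ => Metric.closedBall 0 ρ)) ∩
      ⋂ σ : Equiv.Perm (Fin n), ⋃ i, {p | δ ≤ ‖p.2 (σ i) - p.1 i‖}
  have hS : IsCompact S := by
    refine ((isCompact_univ_pi fun _ => isCompact_closedBall _ _).prod
      (isCompact_univ_pi fun _ => isCompact_closedBall _ _)).inter_right ?_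
    refine isClosed_iInter fun σ => isClosed_iUnion_of_finite fun i => ?_
    exact isClosed_le continuous_const (by fun_prop)
  have hcont : Continuous fun p : (Fin n → ℂ) × (Fin n → ℂ) => coeffDist p.1 p.2 := by
    refine continuous_finsetSum _ fun k _ => ?_
    exact (((continuous_revCoeff k).comp continuous_fst).sub
      ((continuous_revCoeff k).comp continuous_snd)).norm
  have hpos : ∀ p ∈ S, 0 < coeffDist p.1 p.2 := by
    rintro ⟨z, w⟩ ⟨-, hp⟩
    refine lt_of_le_of_ne (Finset.sum_nonneg fun _ _ => norm_nonneg _) fun h0 => ?_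
    have h1 := (Finset.sum_eq_zero_iff_of_nonneg (fun _ _ => norm_nonneg _)).mp h0.symm
    obtain ⟨σ, hσ⟩ := exists_perm_of_listPoly_eq (z := z) (w := w)
      (ext_of_revCoeff_eq fun k hk => by
        simpa [sub_eq_zero] using h1 k (by simpa using Nat.lt_succ_of_le hk))
    obtain ⟨i, hi⟩ := Set.mem_iUnion.mp (Set.mem_iInter.mp hp σ)
    simp only [Set.mem_ofPred_eq, ← hσ i, sub_self, norm_zero] at hi
    linarith
  obtain ⟨η, hη, hmin⟩ : ∃ η > 0, ∀ p ∈ S, η ≤ coeffDist p.1 p.2 := by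
    rcases S.eq_empty_or_nonempty with h | h
    · exact ⟨1, one_pos, by simp [h]⟩
    · obtain ⟨p, hp, hmin⟩ := hS.exists_isMinOn h hcont.continuousOn
      exact ⟨_, hpos p hp, fun q hq => hmin hq⟩
  refine ⟨η, hη, fun z w hz hw hzw => ?_⟩
  by_contra! hcon
  refine (hmin (z, w) ⟨⟨?_, ?_⟩, ?_⟩).not_gt hzw
  · simpa using hz
  · simpa using hw
  · refine Set.mem_iInter.mpr fun σ => Set.mem_iUnion.mpr ?_
    obtain ⟨i, hi⟩ := hcon σ
    exact ⟨i, hi.le⟩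

/-- If `|f| ≤ ε` at all zeros of the polynomials on the segment from `f = listPoly lam` to
`g = listPoly nu`, and these zeros are bounded, then the zeros of `f` and `g` can be matched within
`D`, where `ε ≤ 2 (D / 4) ^ n`. -/
theorem exists_perm_norm_sub_le (hn : n ≠ 0) (lam nu : Fin n → ℂ) {ε D ρ : ℝ} (hε : 0 < ε)
    (hD : 0 ≤ D) (hDε : ε ≤ 2 * (D / 4) ^ n)
    (hroot : ∀ t : ℝ, 0 ≤ t → t ≤ 1 → ∀ x : ℂ,
      (1 - t) * (listPoly lam).eval x + t * (listPoly nu).eval x = 0 →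
        ‖x‖ ≤ ρ ∧ ‖(listPoly lam).eval x‖ ≤ ε) :
    ∃ σ : Equiv.Perm (Fin n), ∀ i, ‖lam i - nu (σ i)‖ ≤ D := by
  -- a common scale at which no two zeros at distance more than `D` are joined by a chain
  have hscale (p : Fin n × Fin n) : ∃ δ > 0, D < ‖lam p.1 - nu p.2‖ → ∀ (K : ℕ) (z : ℕ → ℂ),
      z 0 = lam p.1 → z K = nu p.2 → (∀ j < K, ‖z (j + 1) - z j‖ ≤ δ) →
      ∃ j ≤ K, ε < ‖∏ i, (z j - lam i)‖ := by
    by_cases h : D < ‖lam p.1 - nu p.2‖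
    · obtain ⟨δ, hδ, h'⟩ := exists_chain_scale hn lam hε hD hDε _ _ h
      exact ⟨δ, hδ, fun _ => h'⟩
    · exact ⟨1, one_pos, fun h2 => absurd h2 h⟩
  choose δ' hδ' hchain using hscale
  have : Nonempty (Fin n) := ⟨⟨0, by omega⟩⟩
  obtain ⟨p₀, hp₀⟩ := Finite.exists_min δ'
  obtain ⟨η, hη, hmatch⟩ := exists_forall_coeffDist_lt (n := n) ρ (hδ' p₀)
  obtain ⟨T, hT⟩ := exists_nat_gt (coeffDist lam nu / η)
  have hΦ : 0 ≤ coeffDist lam nu := Finset.sum_nonneg fun _ _ => norm_nonneg _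
  have hT0 : (0 : ℝ) < T := (div_nonneg hΦ hη.le).trans_lt hT
  have hTne : T ≠ 0 := by rintro rfl; simp at hT0
  -- the zeros of the polynomials on the segment from the first to the second polynomial
  have hex (j : ℕ) : ∃ z : Fin n → ℂ, (j = 0 → z = lam) ∧ (j = T → z = nu) ∧
      listPoly z = listPoly lam + C ((j / T : ℝ) : ℂ) * (listPoly nu - listPoly lam) := by
    rcases eq_or_ne j 0 with rfl | hj
    · exact ⟨lam, fun _ => rfl, fun h => absurd h.symm hTne, by simp⟩
    rcases eq_or_ne j T with rfl | hj'
    · exact ⟨nu, fun h => absurd h hj, fun _ => rfl, by rw [div_self hT0.ne']; simp⟩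
    have hdeg : (C ((j / T : ℝ) : ℂ) * (listPoly nu - listPoly lam)).degree <
        (listPoly lam).degree := by
      rcases eq_or_ne (listPoly nu - listPoly lam) 0 with h0 | h0
      · rw [h0, mul_zero, degree_zero]
        exact bot_lt_iff_ne_bot.mpr (degree_ne_bot.mpr (listPoly_monic lam).ne_zero)
      have : (listPoly nu - listPoly lam).degree < (listPoly nu).degree :=
        degree_sub_lt_left (by
          rw [degree_eq_natDegree (listPoly_monic _).ne_zero,
            degree_eq_natDegree (listPoly_monic _).ne_zero, natDegree_listPoly,
            natDegree_listPoly]) (listPoly_monic _).ne_zero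
          (by rw [(listPoly_monic _).leadingCoeff, (listPoly_monic _).leadingCoeff])
      refine (show _ ≤ (listPoly nu - listPoly lam).degree by
        rw [C_mul']; exact degree_smul_le _ _).trans_lt ?_
      rw [degree_eq_natDegree (listPoly_monic _).ne_zero, natDegree_listPoly] at this ⊢
      exact this
    obtain ⟨z, hz⟩ := exists_listPoly_eq (n := n) ((listPoly_monic lam).add_of_left hdeg)
      (by rw [natDegree_add_eq_left_of_degree_lt hdeg, natDegree_listPoly])
    exact ⟨z, fun h => absurd h hj, fun h => absurd h hj', hz⟩
  choose α hα0 hαT hα using hex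
  have hαroot (j : ℕ) (hj : j ≤ T) (i : Fin n) :
      ‖α j i‖ ≤ ρ ∧ ‖(listPoly lam).eval (α j i)‖ ≤ ε := by
    refine hroot (j / T) (by positivity) ((div_le_one hT0).mpr (by exact_mod_cast hj)) _ ?_
    have h1 : (listPoly (α j)).eval (α j i) = 0 := by
      rw [eval_listPoly]; exact Finset.prod_eq_zero (Finset.mem_univ i) (sub_self _)
    rw [hα] at h1
    simp only [eval_add, eval_mul, eval_C, eval_sub] at h1
    linear_combination h1
  have hstep (j : ℕ) : ∃ σ : Equiv.Perm (Fin n), j < T →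
      ∀ i, ‖α (j + 1) (σ i) - α j i‖ ≤ δ' p₀ := by
    by_cases hj : j < T
    · have hrev (j k : ℕ) (hk : k ≤ n) : revCoeff (α j) k =
          revCoeff lam k + ((j / T : ℝ) : ℂ) * (revCoeff nu k - revCoeff lam k) := by
        rw [← coeff_listPoly _ hk, hα, coeff_add, coeff_C_mul, coeff_sub, coeff_listPoly _ hk,
          coeff_listPoly _ hk]
      obtain ⟨σ, hσ⟩ := hmatch (α j) (α (j + 1)) (fun i => (hαroot j hj.le i).1)
        (fun i => (hαroot (j + 1) hj i).1) (by
          have : coeffDist (α j) (α (j + 1)) = coeffDist lam nu / T := by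
            rw [coeffDist, coeffDist, Finset.sum_div]
            refine Finset.sum_congr rfl fun k hk => ?_
            have hk : k ≤ n := by simpa [Nat.lt_succ_iff] using hk
            rw [hrev _ _ hk, hrev _ _ hk]
            have : revCoeff lam k + ((j / T : ℝ) : ℂ) * (revCoeff nu k - revCoeff lam k) -
                (revCoeff lam k + (((j + 1 : ℕ) / T : ℝ) : ℂ) * (revCoeff nu k - revCoeff lam k)) =
                ((1 / T : ℝ) : ℂ) * (revCoeff lam k - revCoeff nu k) := by
              push_cast; ring
            rw [this, norm_mul, Complex.norm_real, Real.norm_of_nonneg (by positivity)]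
            ring
          rw [this]
          exact (div_lt_comm₀ hη hT0).mp hT)
      exact ⟨σ, fun _ => hσ⟩
    · exact ⟨1, fun h => absurd h hj⟩
  choose σ hσ using hstep
  -- `j ↦ α j (τ j i)` is the chain that starts at `lam i`
  let τ : ℕ → Equiv.Perm (Fin n) := fun j => Nat.rec 1 (fun j t => σ j * t) j
  refine ⟨τ T, fun i => ?_⟩
  by_contra! hcon
  obtain ⟨j, hj, hjε⟩ := hchain (i, τ T i) hcon T (fun j => α j (τ j i))
    (by simp [hα0 0 rfl, τ]) (by simp [hαT T rfl])
    (fun j hj => (hσ j hj (τ j i)).trans (hp₀ _))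
  rw [← eval_listPoly] at hjε
  exact hjε.not_ge (hαroot j hj _).2

end Matching

/-! ### The polynomial `J_N(f)` -/

/-- The factor `N ^ (i-1) / ((N-1)(N-2)...(N-i+1))` of `p_i` in `J_N(f)`, for `i ≥ 1`. -/
def jFactor (N i : ℕ) : ℝ := (N : ℝ) ^ (i - 1) / ∏ j ∈ Finset.Icc 1 (i - 1), ((N : ℝ) - j)

section JPoly
variable {n : ℕ}

lemma J_listPoly (N : ℕ) (lam : Fin n → ℂ) :
    J N (listPoly lam) = X ^ n + ∑ i ∈ Finset.Icc 1 n,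
      C ((jFactor N i : ℂ) * revCoeff lam i) * X ^ (n - i) := by
  rw [J, natDegree_listPoly]
  congr 1
  refine Finset.sum_congr rfl fun i hi => ?_
  rw [coeff_listPoly _ (Finset.mem_Icc.mp hi).2]
  simp [jFactor]

lemma sum_C_mul_X_pow_degree_lt (c : ℕ → ℂ) :
    (∑ i ∈ Finset.Icc 1 n, C (c i) * X ^ (n - i)).degree < (n : WithBot ℕ) := by
  refine (degree_sum_le _ _).trans_lt
    ((Finset.sup_lt_iff (WithBot.bot_lt_coe n)).mpr fun i hi => ?_)
  refine (degree_C_mul_X_pow_le _ _).trans_lt ?_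
  rw [Finset.mem_Icc] at hi
  exact WithBot.coe_lt_coe.mpr (show n - i < n by omega)

lemma J_listPoly_monic (N : ℕ) (lam : Fin n → ℂ) :
    (J N (listPoly lam)).Monic ∧ (J N (listPoly lam)).natDegree = n := by
  rw [J_listPoly]
  have h := sum_C_mul_X_pow_degree_lt (n := n) fun i => (jFactor N i : ℂ) * revCoeff lam i
  refine ⟨monic_X_pow_add h, ?_⟩
  rw [natDegree_add_eq_left_of_degree_lt (by rwa [degree_X_pow]), natDegree_X_pow]

lemma coeff_J_listPoly (N : ℕ) (lam : Fin n → ℂ) {i : ℕ} (hi : i ∈ Finset.Icc 1 n) :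
    (J N (listPoly lam)).coeff (n - i) = (jFactor N i : ℂ) * revCoeff lam i := by
  have hi' := Finset.mem_Icc.mp hi
  rw [J_listPoly, coeff_add, coeff_X_pow, if_neg (by omega), zero_add, finsetSum_coeff,
    Finset.sum_eq_single_of_mem i hi]
  · rw [coeff_C_mul_X_pow, if_pos rfl]
  · intro b hb hbi
    have := Finset.mem_Icc.mp hb
    rw [coeff_C_mul_X_pow, if_neg (by omega)]

lemma revCoeff_of_J_eq {N : ℕ} {lam nu : Fin n → ℂ} (h : J N (listPoly lam) = listPoly nu) {i : ℕ}
    (hi : i ∈ Finset.Icc 1 n) : revCoeff nu i = (jFactor N i : ℂ) * revCoeff lam i := by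
  rw [← coeff_listPoly _ (Finset.mem_Icc.mp hi).2, ← h, coeff_J_listPoly N lam hi]

lemma eval_listPoly_eq_sum (z : Fin n → ℂ) (x : ℂ) :
    (listPoly z).eval x = ∑ i ∈ Finset.range (n + 1), revCoeff z i * x ^ (n - i) := by
  rw [eval_eq_sum_range, natDegree_listPoly, ← Finset.sum_range_reflect]
  refine Finset.sum_congr rfl fun i hi => ?_
  rw [Finset.mem_range] at hi
  rw [Nat.add_sub_cancel, coeff_listPoly z (by omega)]

lemma powerSum_mul (c : ℂ) (z : Fin n → ℂ) (k : ℕ) :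
    powerSum (fun i => c * z i) k = c ^ k * powerSum z k := by
  simp [powerSum, mul_pow, Finset.mul_sum]

lemma revCoeff_mul (c : ℂ) (z : Fin n → ℂ) (k : ℕ) :
    revCoeff (fun i => c * z i) k = c ^ k * revCoeff z k := by
  simp only [revCoeff, Finset.esymm_map_val]
  rw [mul_left_comm]
  congr 1
  rw [Finset.mul_sum]
  refine Finset.sum_congr rfl fun t ht => ?_
  rw [Finset.prod_mul_distrib, Finset.prod_const, (Finset.mem_powersetCard.mp ht).2]

lemma factorial_eq_mul_prod {N i : ℕ} (hi : 1 ≤ i) (hN : i ≤ N) :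
    (N.factorial : ℝ) = (N * ∏ j ∈ Finset.Icc 1 (i - 1), ((N : ℝ) - j)) * (N - i).factorial := by
  obtain ⟨i, rfl⟩ := Nat.exists_eq_add_of_le' hi
  simp only [Nat.add_sub_cancel]
  induction i with
  | zero => simp [Nat.mul_factorial_pred (show N ≠ 0 by omega), ← Nat.cast_mul]
  | succ i ih =>
    rw [ih (by omega) (by omega), Finset.prod_Icc_succ_top (by omega),
      ← Nat.mul_factorial_pred (show N - (i + 1) ≠ 0 by omega)]
    rw [show N - (i + 1) - 1 = N - (i + 1 + 1) by omega]
    push_cast [show i + 1 ≤ N by omega]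
    ring

lemma factorial_mul_jFactor {N i : ℕ} (hi : 1 ≤ i) (hN : i ≤ N) :
    N.factorial * jFactor N i = (N : ℝ) ^ i * (N - i).factorial := by
  have hne : ∏ j ∈ Finset.Icc 1 (i - 1), ((N : ℝ) - j) ≠ 0 := by
    refine Finset.prod_ne_zero_iff.mpr fun j hj => ?_
    rw [Finset.mem_Icc] at hj
    have : (j : ℝ) < N := by exact_mod_cast (show j < N by omega)
    linarith
  rw [factorial_eq_mul_prod hi hN, jFactor, ← mul_pow_sub_one (show i ≠ 0 by omega)]
  field_simp

/-- The factors in `J_N(f)` cancel the factors `N! / (N - i)!` that appear in the characteristic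
polynomial of the patterned matrix. -/
theorem charpoly_newtonMatrix_of_J_eq {N : ℕ} (hn : n ≠ 0) (hN : n ≤ N) {lam μ : Fin n → ℂ}
    (h : J N (listPoly lam) = listPoly fun i => (N : ℂ) * μ i) :
    (newtonMatrix N (powerSum μ)).charpoly = X ^ (N - n) * listPoly lam := by
  have hN0 : (N : ℂ) ≠ 0 := by exact_mod_cast (show N ≠ 0 by omega)
  -- the factors of `J_N` and of the characteristic polynomial are inverse to each other
  have hcoeff (i : ℕ) (hi : i ≤ n) :
      (N.factorial : ℂ) * revCoeff μ i = (N - i).factorial * revCoeff lam i := by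
    rcases Nat.eq_zero_or_pos i with rfl | hi0
    · simp [revCoeff_zero]
    have h1 := revCoeff_of_J_eq h (Finset.mem_Icc.mpr ⟨hi0, hi⟩)
    have h2 : (N.factorial : ℂ) * (jFactor N i : ℂ) = (N : ℂ) ^ i * ((N - i).factorial : ℂ) := by
      exact_mod_cast congrArg ((↑) : ℝ → ℂ) (factorial_mul_jFactor hi0 (hi.trans hN))
    rw [revCoeff_mul] at h1
    refine mul_left_cancel₀ (pow_ne_zero i hN0) ?_
    linear_combination (N.factorial : ℂ) * h1 + revCoeff lam i * h2
  refine Polynomial.funext fun x => ?_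
  rw [eval_charpoly_newtonMatrix _ _ (by omega), eval_mul, eval_pow, eval_X, eval_listPoly_eq_sum,
    expCoeff, Finset.Nat.sum_antidiagonal_eq_sum_range_succ
      (fun a b => revCoeff μ a * (x ^ b / (b.factorial : ℂ))), Finset.mul_sum, Finset.mul_sum]
  symm
  rw [← Finset.sum_subset (Finset.range_mono (show n + 1 ≤ N.succ by omega))]
  · refine Finset.sum_congr rfl fun i hi => ?_
    have hi : i ≤ n := by simpa [Nat.lt_succ_iff] using hi
    have hf : ((N - i).factorial : ℂ) ≠ 0 := by exact_mod_cast Nat.factorial_ne_zero _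
    rw [← mul_assoc (N.factorial : ℂ), hcoeff i hi, show N - i = (N - n) + (n - i) by omega,
      pow_add]
    rw [show N - i = (N - n) + (n - i) by omega] at hf
    field_simp
  · intro i _ hi
    rw [revCoeff_of_lt μ (by simpa using hi), zero_mul, mul_zero]

end JPoly

section Conj
variable {n : ℕ}

lemma conj_revCoeff (z : Fin n → ℂ) (k : ℕ) :
    starRingEnd ℂ (revCoeff z k) = revCoeff (fun i => starRingEnd ℂ (z i)) k := by
  simp only [revCoeff, Finset.esymm_map_val, map_mul, map_pow, map_neg, map_one, map_sum, map_prod]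

/-- By Newton's identities, a polynomial whose zeros have real power sums has real coefficients. -/
lemma revCoeff_real_of_powerSum_real {z : Fin n → ℂ}
    (h : ∀ k, 1 ≤ k → starRingEnd ℂ (powerSum z k) = powerSum z k) (k : ℕ) :
    starRingEnd ℂ (revCoeff z k) = revCoeff z k := by
  induction k using Nat.strong_induction_on with
  | _ k ih =>
    rcases k with _ | k
    · simp [revCoeff_zero]
    have h1 : (k : ℂ) + 1 ≠ 0 := by exact_mod_cast k.succ_ne_zero
    refine mul_left_cancel₀ h1 ?_
    have h2 := congrArg (starRingEnd ℂ) (newton_revCoeff z k)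
    rw [map_mul] at h2
    simp only [map_add, map_natCast, map_one, map_neg, map_sum, map_mul] at h2
    rw [h2, newton_revCoeff]
    congr 1
    refine Finset.sum_congr rfl fun a ha => ?_
    rw [Finset.HasAntidiagonal.mem_antidiagonal] at ha
    rw [ih a.1 (by omega), h _ (by omega)]

/-- The zeros of a real polynomial are permuted by complex conjugation. -/
lemma exists_perm_conj {z : Fin n → ℂ}
    (h : ∀ k, starRingEnd ℂ (revCoeff z k) = revCoeff z k) :
    ∃ σ : Equiv.Perm (Fin n), ∀ i, starRingEnd ℂ (z i) = z (σ i) :=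
  exists_perm_of_listPoly_eq (ext_of_revCoeff_eq fun k _ => by rw [← conj_revCoeff, h])

lemma powerSum_comp_perm (z : Fin n → ℂ) (σ : Equiv.Perm (Fin n)) (k : ℕ) :
    powerSum (fun i => z (σ i)) k = powerSum z k :=
  Equiv.sum_comp σ fun i => z i ^ k

lemma conj_powerSum (z : Fin n → ℂ) (k : ℕ) :
    starRingEnd ℂ (powerSum z k) = powerSum (fun i => starRingEnd ℂ (z i)) k := by
  simp [powerSum]

end Conj

/-! ### Perturbation of `f` into `J_N(f)` -/

section Perturbation

lemma prod_sub_le_pow {N : ℝ} {m : ℕ} (hm : (m : ℝ) ≤ N) :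
    0 ≤ ∏ j ∈ Finset.Icc 1 m, (N - j) ∧ ∏ j ∈ Finset.Icc 1 m, (N - j) ≤ N ^ m := by
  have hj (j : ℕ) (hj : j ∈ Finset.Icc 1 m) : 0 ≤ N - j ∧ N - j ≤ N := by
    have h1 : (j : ℝ) ≤ m := by exact_mod_cast (Finset.mem_Icc.mp hj).2
    have h2 : (0 : ℝ) ≤ j := j.cast_nonneg
    constructor <;> linarith
  refine ⟨Finset.prod_nonneg fun j h => (hj j h).1, ?_⟩
  simpa using Finset.prod_le_prod (fun j h => (hj j h).1) fun j h => (hj j h).2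

lemma pow_mul_le_two_mul_prod_sub {N : ℝ} {m : ℕ} (hm : (m : ℝ) ≤ N) :
    N ^ m * (2 * N - m * (m + 1)) ≤ 2 * N * ∏ j ∈ Finset.Icc 1 m, (N - j) := by
  induction m with
  | zero => simp
  | succ m ih =>
    push_cast at hm
    have h1 := mul_le_mul_of_nonneg_right (ih (by linarith))
      (show (0 : ℝ) ≤ N - (m + 1) by linarith)
    rw [Finset.prod_Icc_succ_top (by omega)]
    have hN : 0 ≤ N := by linarith [(m.cast_nonneg : (0 : ℝ) ≤ m)]
    have h2 : 0 ≤ N ^ m * (m * (m + 1) ^ 2) := by positivity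
    push_cast
    nlinarith [pow_succ N m]

lemma jFactor_bounds {N i : ℕ} (hi : 1 ≤ i) (hN : i * (i - 1) ≤ N) (hN0 : i ≤ N) :
    1 ≤ jFactor N i ∧ jFactor N i ≤ 1 + (i : ℝ) * (i - 1) / N := by
  obtain ⟨m, rfl⟩ := Nat.exists_eq_add_of_le' hi
  simp only [Nat.add_sub_cancel] at hN
  have hN' : ((m : ℝ) + 1) * m ≤ N := by exact_mod_cast hN
  have hm : (m : ℝ) + 1 ≤ N := by exact_mod_cast hN0
  have hm0 : (0 : ℝ) ≤ m := m.cast_nonneg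
  have hNpos : (0 : ℝ) < N := by linarith
  have h1 := prod_sub_le_pow (N := N) (m := m) (by linarith)
  have h2 := pow_mul_le_two_mul_prod_sub (N := N) (m := m) (by linarith)
  have hpow : (0 : ℝ) < (N : ℝ) ^ m := pow_pos hNpos m
  have hpos : 0 < ∏ j ∈ Finset.Icc 1 m, ((N : ℝ) - j) := by
    have : 0 < (N : ℝ) ^ m * (2 * N - m * (m + 1)) := mul_pos hpow (by linarith)
    exact pos_of_mul_pos_right (this.trans_le h2) (by positivity)
  rw [jFactor, Nat.add_sub_cancel]
  refine ⟨(one_le_div hpos).mpr h1.2, (div_le_iff₀ hpos).mpr ?_⟩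
  set P := ∏ j ∈ Finset.Icc 1 m, ((N : ℝ) - j)
  push_cast
  set a : ℝ := (m + 1) * m with ha
  have ha0 : 0 ≤ a := by positivity
  have h3 : (N : ℝ) ^ m * (2 * N) ≤ (1 + a / N) * (2 * N * P) := by
    refine le_trans ?_ (mul_le_mul_of_nonneg_left h2 (by positivity))
    have h5 : (2 * N : ℝ) ≤ (1 + a / N) * (2 * N - m * (m + 1)) := by
      have : (1 + a / N) * (2 * N - m * (m + 1)) = 2 * N + a * (N - a) / N := by
        field_simp; rw [ha]; ring
      rw [this]
      have : 0 ≤ a * (N - a) / N := div_nonneg (mul_nonneg ha0 (by linarith)) hNpos.le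
      linarith
    nlinarith
  have h4 : ((m : ℝ) + 1) * (m + 1 - 1) = a := by rw [ha]; ring
  rw [h4]
  nlinarith

/-- A partial sum of `∑ i (i - 1) 2 ^ (-i) = 4`. -/
lemma sum_mul_pred_mul_half_pow_le (n : ℕ) :
    ∑ i ∈ Finset.Icc 1 n, (i : ℝ) * (i - 1) * (1 / 2) ^ i ≤ 4 := by
  have h : ∑ i ∈ Finset.Icc 1 n, (i : ℝ) * (i - 1) * (1 / 2) ^ i =
      4 - (n ^ 2 + 3 * n + 4) * (1 / 2) ^ n := by
    induction n with
    | zero => simp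
    | succ n ih => rw [Finset.sum_Icc_succ_top (by omega), ih]; push_cast; ring
  rw [h]
  have : (0 : ℝ) ≤ (n ^ 2 + 3 * n + 4) * (1 / 2) ^ n := by positivity
  linarith

lemma sum_half_pow (n : ℕ) : ∑ i ∈ Finset.Icc 1 n, (1 / 2 : ℝ) ^ i = 1 - (1 / 2) ^ n := by
  induction n with
  | zero => simp
  | succ n ih => rw [Finset.sum_Icc_succ_top (by omega), ih]; ring

lemma sum_jFactor_sub_one_le {n N : ℕ} (hN : n * n ≤ N) :
    ∑ i ∈ Finset.Icc 1 n, (jFactor N i - 1) * (1 / 2) ^ i ≤ 4 / N := by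
  calc ∑ i ∈ Finset.Icc 1 n, (jFactor N i - 1) * (1 / 2) ^ i
      ≤ ∑ i ∈ Finset.Icc 1 n, (i : ℝ) * (i - 1) / N * (1 / 2) ^ i := by
        refine Finset.sum_le_sum fun i hi => mul_le_mul_of_nonneg_right ?_ (by positivity)
        rw [Finset.mem_Icc] at hi
        have := (jFactor_bounds (N := N) hi.1 ((Nat.mul_le_mul hi.2 (by omega)).trans hN)
          ((hi.2.trans (Nat.le_mul_self n)).trans hN)).2
        linarith
    _ = (∑ i ∈ Finset.Icc 1 n, (i : ℝ) * (i - 1) * (1 / 2) ^ i) / N := by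
        rw [Finset.sum_div]; exact Finset.sum_congr rfl fun _ _ => by ring
    _ ≤ 4 / N := by gcongr; exact sum_mul_pred_mul_half_pow_le n

lemma eval_listPoly_eq_add_sum {n : ℕ} (z : Fin n → ℂ) (x : ℂ) :
    (listPoly z).eval x = x ^ n + ∑ i ∈ Finset.Icc 1 n, revCoeff z i * x ^ (n - i) := by
  rw [eval_listPoly_eq_sum, Finset.range_eq_Ico, Finset.sum_eq_sum_Ico_succ_bot (by omega),
    revCoeff_zero, one_mul, Nat.sub_zero]
  rfl

/-- The zeros of the polynomials on the segment from `f` to `J_N(f)` lie in the disc of radius `γ`,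
and `f` is small at them. For `|x| > γ` the leading term of such a polynomial dominates, because
`∑ jFactor N i * 2 ^ (-i) ≤ 1 - 2 ^ (-n) + 4 / N < 1`. -/
lemma norm_le_of_segment_root {n N : ℕ} {γ : ℝ} (hγ : 0 < γ) (hN : n * n ≤ N) (hN2 : 4 * 2 ^ n < N)
    {lam nu : Fin n → ℂ} (hlam : ∀ i ∈ Finset.Icc 1 n, ‖revCoeff lam i‖ ≤ (γ / 2) ^ i)
    (hnu : ∀ i ∈ Finset.Icc 1 n, revCoeff nu i = (jFactor N i : ℂ) * revCoeff lam i)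
    {t : ℝ} (ht0 : 0 ≤ t) (ht1 : t ≤ 1) {x : ℂ}
    (hx : (1 - t) * (listPoly lam).eval x + t * (listPoly nu).eval x = 0) :
    ‖x‖ ≤ γ ∧ ‖(listPoly lam).eval x‖ ≤ 4 * γ ^ n / N := by
  have hc (i : ℕ) (hi : i ∈ Finset.Icc 1 n) : 1 ≤ jFactor N i := by
    rw [Finset.mem_Icc] at hi
    exact (jFactor_bounds (N := N) hi.1 ((Nat.mul_le_mul hi.2 (by omega)).trans hN)
          ((hi.2.trans (Nat.le_mul_self n)).trans hN)).1
  have hNpos : (0 : ℝ) < N := by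
    have : 0 < N := by omega
    exact_mod_cast this
  have hsum := sum_jFactor_sub_one_le hN
  have hdiff : (listPoly nu).eval x - (listPoly lam).eval x =
      ∑ i ∈ Finset.Icc 1 n, ((jFactor N i - 1 : ℝ) : ℂ) * revCoeff lam i * x ^ (n - i) := by
    rw [eval_listPoly_eq_add_sum, eval_listPoly_eq_add_sum, add_sub_add_left_eq_sub,
      ← Finset.sum_sub_distrib]
    refine Finset.sum_congr rfl fun i hi => ?_
    rw [hnu i hi]; push_cast; ring
  have hxγ : ‖x‖ ≤ γ := by
    by_contra! hcon
    have hxpos : 0 < ‖x‖ := hγ.trans hcon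
    have h1 : x ^ n = -∑ i ∈ Finset.Icc 1 n,
        ((1 + t * (jFactor N i - 1) : ℝ) : ℂ) * revCoeff lam i * x ^ (n - i) := by
      have h2 : (listPoly lam).eval x + t * ((listPoly nu).eval x - (listPoly lam).eval x) = 0 := by
        linear_combination hx
      rw [hdiff, eval_listPoly_eq_add_sum, add_assoc, Finset.mul_sum,
        ← Finset.sum_add_distrib] at h2
      rw [eq_neg_iff_add_eq_zero, ← h2]
      congr 1
      refine Finset.sum_congr rfl fun i hi => ?_
      push_cast; ring
    have h2 : ‖x‖ ^ n ≤ (∑ i ∈ Finset.Icc 1 n, jFactor N i * (1 / 2) ^ i) * ‖x‖ ^ n := by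
      rw [Finset.sum_mul]
      conv_lhs => rw [← norm_pow, h1, norm_neg]
      refine norm_sum_le_of_le _ fun i hi => ?_
      have hci := hc i hi
      have h3 : 0 ≤ 1 + t * (jFactor N i - 1) := by nlinarith
      rw [norm_mul, norm_mul, Complex.norm_real, Real.norm_of_nonneg h3, norm_pow]
      have h4 : ‖x‖ ^ n = ‖x‖ ^ i * ‖x‖ ^ (n - i) := by
        rw [← pow_add]; congr 1; rw [Finset.mem_Icc] at hi; omega
      rw [h4, ← mul_assoc]
      refine mul_le_mul_of_nonneg_right ?_ (by positivity)
      rw [mul_assoc]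
      refine mul_le_mul (by nlinarith) ((hlam i hi).trans ?_) (norm_nonneg _) (by linarith)
      rw [← mul_pow]
      gcongr
      linarith
    have h3 : 1 ≤ ∑ i ∈ Finset.Icc 1 n, jFactor N i * (1 / 2) ^ i := by
      have := pow_pos hxpos n
      by_contra! h
      nlinarith
    have h4 : ∑ i ∈ Finset.Icc 1 n, jFactor N i * (1 / 2) ^ i =
        ∑ i ∈ Finset.Icc 1 n, (jFactor N i - 1) * (1 / 2) ^ i + (1 - (1 / 2) ^ n) := by
      rw [← sum_half_pow, ← Finset.sum_add_distrib]
      exact Finset.sum_congr rfl fun _ _ => by ring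
    have h5 : 4 / (N : ℝ) < (1 / 2) ^ n := by
      have : (4 : ℝ) * 2 ^ n < N := by exact_mod_cast hN2
      rw [div_lt_iff₀ hNpos, one_div, inv_pow, inv_mul_eq_div, lt_div_iff₀ (by positivity)]
      exact this
    linarith
  refine ⟨hxγ, ?_⟩
  have h1 : (listPoly lam).eval x = -(t * ((listPoly nu).eval x - (listPoly lam).eval x)) := by
    linear_combination hx
  rw [h1, norm_neg, norm_mul, Complex.norm_real, Real.norm_of_nonneg ht0, hdiff]
  refine (mul_le_of_le_one_left (norm_nonneg _) ht1).trans ?_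
  calc _ ≤ ∑ i ∈ Finset.Icc 1 n, (jFactor N i - 1) * (1 / 2) ^ i * γ ^ n := by
        refine norm_sum_le_of_le _ fun i hi => ?_
        have hci := hc i hi
        rw [norm_mul, norm_mul, Complex.norm_real, Real.norm_of_nonneg (by linarith), norm_pow]
        have h4 : γ ^ n = γ ^ i * γ ^ (n - i) := by
          rw [← pow_add]; congr 1; rw [Finset.mem_Icc] at hi; omega
        rw [h4, ← mul_assoc, mul_assoc (jFactor N i - 1) ((1 / 2) ^ i), ← mul_pow,
          one_div_mul_eq_div]
        have := hlam i hi
        have h6 : 0 ≤ jFactor N i - 1 := by linarith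
        gcongr
    _ ≤ 4 / N * γ ^ n := by rw [← Finset.sum_mul]; gcongr
    _ = _ := by ring

end Perturbation

section PowerSums
variable {n : ℕ}

lemma norm_pow_sub_pow_le {a b : ℂ} {C : ℝ} (ha : ‖a‖ ≤ C) (hb : ‖b‖ ≤ C) (k : ℕ) :
    ‖a ^ k - b ^ k‖ ≤ k * C ^ (k - 1) * ‖a - b‖ := by
  have hC : 0 ≤ C := (norm_nonneg a).trans ha
  rw [← (Commute.all a b).geom_sum₂_mul, norm_mul]
  refine mul_le_mul_of_nonneg_right ?_ (norm_nonneg _)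
  refine (norm_sum_le_of_le _ (f := fun i => a ^ i * b ^ (k - 1 - i))
    (n := fun _ => C ^ (k - 1)) fun i hi => ?_).trans (by simp)
  rw [Finset.mem_range] at hi
  rw [norm_mul, norm_pow, norm_pow, show C ^ (k - 1) = C ^ i * C ^ (k - 1 - i) by
    rw [← pow_add]; congr 1; omega]
  gcongr

lemma norm_powerSum_sub_le {z w : Fin n → ℂ} {C D : ℝ} (hz : ∀ i, ‖z i‖ ≤ C) (hw : ∀ i, ‖w i‖ ≤ C)
    (hzw : ∀ i, ‖z i - w i‖ ≤ D) (k : ℕ) :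
    ‖powerSum z k - powerSum w k‖ ≤ n * (k * C ^ (k - 1) * D) := by
  rw [powerSum, powerSum, ← Finset.sum_sub_distrib]
  refine (norm_sum_le_of_le _ (n := fun _ => k * C ^ (k - 1) * D) fun i _ => ?_).trans (by simp)
  have hC : 0 ≤ C := (norm_nonneg _).trans (hz i)
  refine (norm_pow_sub_pow_le (hz i) (hw i) k).trans ?_
  gcongr
  exact hzw i

/-- A real entry that is large compared with the others makes the power sum positive. -/
lemma powerSum_re_pos_of_dominant [NeZero n] {z : Fin n → ℂ} {a b : ℝ} {k : ℕ} (hb : 0 ≤ b)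
    (hz0 : ((z 0).re : ℂ) = z 0) (hz0b : b ≤ (z 0).re) (hz : ∀ i, i ≠ 0 → ‖z i‖ ≤ a)
    (hab : ((n : ℝ) - 1) * a ^ k < b ^ k) : 0 < (powerSum z k).re := by
  rw [powerSum, Complex.re_sum, ← Finset.add_sum_erase _ _ (Finset.mem_univ 0)]
  have h1 : b ^ k ≤ (z 0 ^ k).re := by
    rw [← hz0, ← Complex.ofReal_pow, Complex.ofReal_re]
    gcongr
  have h2 : -(((n : ℝ) - 1) * a ^ k) ≤ ∑ i ∈ Finset.univ.erase 0, (z i ^ k).re := by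
    have : ∑ i ∈ Finset.univ.erase (0 : Fin n), -(a ^ k) = -(((n : ℝ) - 1) * a ^ k) := by
      rw [Finset.sum_const, Finset.card_erase_of_mem (Finset.mem_univ _), Finset.card_univ,
        Fintype.card_fin, nsmul_eq_mul, Nat.cast_sub (NeZero.one_le), Nat.cast_one]
      ring
    rw [← this]
    refine Finset.sum_le_sum fun i hi => ?_
    have h3 := (Complex.abs_re_le_norm (z i ^ k))
    have h4 : ‖z i ^ k‖ ≤ a ^ k := by
      rw [norm_pow]
      exact pow_le_pow_left₀ (norm_nonneg _) (hz i (Finset.ne_of_mem_erase hi)) k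
    linarith [(abs_le.mp h3).1]
  linarith

end PowerSums

/-! ### The constants of the theorem and the signs of the power sums -/

section Constants
variable {n : ℕ}

lemma two_le_gam (lam : Fin n → ℂ) : 2 ≤ gam lam := by
  have : (1 : ℝ) ≤ (Finset.Icc 1 n).fold max 1 fun i => ‖listCoeff lam i‖ ^ (1 / (i : ℝ)) :=
    (Finset.le_fold_max _).mpr (Or.inl le_rfl)
  rw [gam]; linarith

lemma norm_revCoeff_le_gam (lam : Fin n → ℂ) {i : ℕ} (hi : i ∈ Finset.Icc 1 n) :
    ‖revCoeff lam i‖ ≤ (gam lam / 2) ^ i := by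
  have h1 : ‖listCoeff lam i‖ ^ (1 / (i : ℝ)) ≤ gam lam / 2 := by
    rw [gam, mul_div_cancel_left₀ _ two_ne_zero]
    exact (Finset.le_fold_max _).mpr (Or.inr ⟨i, hi, le_rfl⟩)
  rw [Finset.mem_Icc] at hi
  have h2 : listCoeff lam i = revCoeff lam i := coeff_listPoly lam hi.2
  rw [h2] at h1
  have h3 : ‖revCoeff lam i‖ = (‖revCoeff lam i‖ ^ (1 / (i : ℝ))) ^ i := by
    rw [one_div, Real.rpow_inv_natCast_pow (norm_nonneg _) (by omega)]
  rw [h3]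
  exact pow_le_pow_left₀ (by positivity) h1 i

variable [NeZero n]

lemma lamZero_nonneg (lam : Fin n → ℂ) : 0 ≤ lamZero lam :=
  (Finset.le_fold_max _).mpr (Or.inl le_rfl)

lemma norm_le_lamZero (lam : Fin n → ℂ) {j : Fin n} (hj : j ≠ 0) : ‖lam j‖ ≤ lamZero lam :=
  (Finset.le_fold_max _).mpr (Or.inr ⟨j, by simp [hj], le_rfl⟩)

lemma lamZero_lt_lamOne (hn : 2 ≤ n) {lam : Fin n → ℂ}
    (h : ∀ j : Fin n, j ≠ 0 → ‖lam j‖ < lamOne lam) : lamZero lam < lamOne lam := by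
  refine (Finset.fold_max_lt _).mpr ⟨?_, fun j hj => h j (Finset.ne_of_mem_erase hj)⟩
  refine (norm_nonneg _).trans_lt (h ⟨1, by omega⟩ ?_)
  simp [Fin.ext_iff]

lemma minM_pos {lam : Fin n → ℂ} (hs : ∀ k, 2 ≤ k → 0 < (powerSum lam k).re) : 0 < minM lam :=
  (Finset.lt_fold_min _).mpr ⟨one_pos, fun k hk => hs k (Finset.mem_Icc.mp hk).1⟩

lemma minM_le_one (lam : Fin n → ℂ) : minM lam ≤ 1 :=
  (Finset.fold_min_le _).mpr (Or.inl le_rfl)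

lemma minM_le_powerSum (lam : Fin n → ℂ) {k : ℕ} (hk : 2 ≤ k) (hk' : k ≤ NZero lam) :
    minM lam ≤ (powerSum lam k).re :=
  (Finset.fold_min_le _).mpr (Or.inr ⟨k, Finset.mem_Icc.mpr ⟨hk, hk'⟩, le_rfl⟩)

lemma one_lt_ell {lam : Fin n → ℂ} (h : lamZero lam < lamOne lam) : 1 < ell lam := by
  have := lamZero_nonneg lam
  rw [ell, one_lt_div (by linarith)]
  linarith

lemma one_le_NZero (hn : 2 ≤ n) {lam : Fin n → ℂ} (h : lamZero lam < lamOne lam) :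
    1 ≤ NZero lam := by
  have hn' : (2 : ℝ) ≤ n := by exact_mod_cast hn
  rw [NZero, Nat.one_le_ceil_iff]
  exact div_pos (Real.log_pos (by linarith)) (Real.log_pos (one_lt_ell h))

lemma le_ell_pow (hn : 2 ≤ n) {lam : Fin n → ℂ} (h : lamZero lam < lamOne lam) {k : ℕ}
    (hk : NZero lam ≤ k) : 2 * (n : ℝ) - 2 ≤ ell lam ^ k := by
  have hn' : (2 : ℝ) ≤ n := by exact_mod_cast hn
  have hl := one_lt_ell h
  have h1 : Real.log (2 * (n : ℝ) - 2) / Real.log (ell lam) ≤ k :=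
    (Nat.le_ceil _).trans (Nat.cast_le.mpr hk)
  rw [div_le_iff₀ (Real.log_pos hl), ← Real.log_pow] at h1
  exact (Real.log_le_log_iff (by linarith) (by positivity)).mp h1

lemma smallR_pos {lam : Fin n → ℂ} (h : lamZero lam < lamOne lam) : 0 < smallR lam :=
  lt_min (by rw [gapR]; linarith) one_pos

/-- The base `B` of the power in `bigN lam = ⌈2 B ^ n⌉`. -/
def bigNBase (lam : Fin n → ℂ) : ℝ :=
  (16 * gam lam * (n : ℝ) * (NZero lam : ℝ) * (bigm lam + smallR lam) ^ (NZero lam - 1)) /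
    (Real.sqrt 3 * minM lam * smallR lam)

lemma two_mul_bigNBase_pow_le (lam : Fin n → ℂ) : 2 * bigNBase lam ^ n ≤ bigN lam :=
  Nat.le_ceil _

lemma sqrt_three_le_two : Real.sqrt 3 ≤ 2 :=
  Real.sqrt_le_iff.mpr ⟨by norm_num, by norm_num⟩

lemma one_le_bigm_add_smallR {lam : Fin n → ℂ} (h : lamZero lam < lamOne lam) :
    1 ≤ bigm lam + smallR lam := by
  have h1 : 1 ≤ bigm lam := le_max_left _ _
  linarith [smallR_pos h]

lemma four_le_bigNBase (hn : 2 ≤ n) {lam : Fin n → ℂ} (h : lamZero lam < lamOne lam)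
    (hs : ∀ k, 2 ≤ k → 0 < (powerSum lam k).re) : 4 ≤ bigNBase lam := by
  have hM := minM_pos hs
  have hr := smallR_pos h
  have hn' : (2 : ℝ) ≤ n := by exact_mod_cast hn
  have hN0 : (1 : ℝ) ≤ NZero lam := by exact_mod_cast one_le_NZero hn h
  have hpow : 1 ≤ (bigm lam + smallR lam) ^ (NZero lam - 1) :=
    one_le_pow₀ (one_le_bigm_add_smallR h)
  have hg := two_le_gam lam
  have hr1 : smallR lam ≤ 1 := min_le_right _ _
  rw [bigNBase, le_div_iff₀ (by positivity)]
  have h1 : Real.sqrt 3 * minM lam * smallR lam ≤ 2 * 1 * 1 := by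
    gcongr
    · exact sqrt_three_le_two
    · exact minM_le_one lam
  have h2 : (16 : ℝ) * 2 * 2 * 1 * 1 ≤ 16 * gam lam * (n : ℝ) * (NZero lam : ℝ) *
      (bigm lam + smallR lam) ^ (NZero lam - 1) := by gcongr
  linarith

lemma bigN_bounds (hn : 2 ≤ n) {lam : Fin n → ℂ} (h : lamZero lam < lamOne lam)
    (hs : ∀ k, 2 ≤ k → 0 < (powerSum lam k).re) :
    n * n ≤ bigN lam ∧ 4 * 2 ^ n < bigN lam := by
  have h1 : 2 * 4 ^ n ≤ bigN lam := by
    have := two_mul_bigNBase_pow_le lam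
    have h2 : (4 : ℝ) ^ n ≤ bigNBase lam ^ n :=
      pow_le_pow_left₀ (by norm_num) (four_le_bigNBase hn h hs) n
    exact_mod_cast (show (2 : ℝ) * 4 ^ n ≤ bigN lam by linarith)
  have h2 : (4 : ℕ) ^ n = 2 ^ n * 2 ^ n := by rw [← mul_pow]; norm_num
  have h3 : n ≤ 2 ^ n := Nat.lt_two_pow_self.le
  have h4 : 2 ^ 2 ≤ 2 ^ n := Nat.pow_le_pow_right (by norm_num) hn
  constructor <;> nlinarith

/-- The bound `D = 4 γ / B` on the distance of matched zeros, with `B = bigNBase lam`. As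
`N ≥ 2 B ^ n`, it satisfies `4 γ ^ n / N ≤ 2 (D / 4) ^ n`. -/
def rootDist (lam : Fin n → ℂ) : ℝ := 4 * gam lam / bigNBase lam

/-- The bound for the change of a power sum of exponent at most `N_0` when every entry moves by at
most `rootDist`. -/
lemma rootDist_bound (hn : 2 ≤ n) {lam : Fin n → ℂ} (h : lamZero lam < lamOne lam)
    (hs : ∀ k, 2 ≤ k → 0 < (powerSum lam k).re) :
    n * (NZero lam * (bigm lam + smallR lam) ^ (NZero lam - 1) * rootDist lam) ≤
      minM lam * smallR lam / 2 := by
  have hB := four_le_bigNBase hn h hs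
  have hM := minM_pos hs
  have hr := smallR_pos h
  have hg := two_le_gam lam
  have h1 : bigNBase lam * (Real.sqrt 3 * minM lam * smallR lam) = 16 * gam lam * (n : ℝ) *
      (NZero lam : ℝ) * (bigm lam + smallR lam) ^ (NZero lam - 1) :=
    div_mul_cancel₀ _ (by positivity)
  have h2 : n * (NZero lam * (bigm lam + smallR lam) ^ (NZero lam - 1) * rootDist lam) =
      Real.sqrt 3 * minM lam * smallR lam / 4 := by
    rw [rootDist, mul_div_assoc', mul_div_assoc', div_eq_iff (by positivity)]
    linear_combination (-1 / 4) * h1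
  have h3 : Real.sqrt 3 * minM lam * smallR lam ≤ 2 * minM lam * smallR lam := by
    gcongr
    exact sqrt_three_le_two
  linarith

lemma rootDist_pos (hn : 2 ≤ n) {lam : Fin n → ℂ} (h : lamZero lam < lamOne lam)
    (hs : ∀ k, 2 ≤ k → 0 < (powerSum lam k).re) : 0 < rootDist lam := by
  have hB := four_le_bigNBase hn h hs
  have hg := two_le_gam lam
  rw [rootDist]
  positivity

lemma rootDist_le (hn : 2 ≤ n) {lam : Fin n → ℂ} (h : lamZero lam < lamOne lam)
    (hs : ∀ k, 2 ≤ k → 0 < (powerSum lam k).re) : rootDist lam ≤ smallR lam / 2 := by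
  have h1 := rootDist_bound hn h hs
  have hn' : (1 : ℝ) ≤ n := by exact_mod_cast (show 1 ≤ n by omega)
  have hN0 : (1 : ℝ) ≤ NZero lam := by exact_mod_cast one_le_NZero hn h
  have hpow : 1 ≤ (bigm lam + smallR lam) ^ (NZero lam - 1) :=
    one_le_pow₀ (one_le_bigm_add_smallR h)
  have hD := rootDist_pos hn h hs
  have h2 : 1 * (1 * 1 * rootDist lam) ≤
      n * (NZero lam * (bigm lam + smallR lam) ^ (NZero lam - 1) * rootDist lam) := by gcongr
  have h3 : minM lam * smallR lam ≤ 1 * smallR lam :=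
    mul_le_mul_of_nonneg_right (minM_le_one lam) (smallR_pos h).le
  linarith

/-- The zeros of `J_N(f)` are matched with those of `f` within `rootDist`. -/
lemma exists_perm_of_J_eq (hn : 2 ≤ n) {lam : Fin n → ℂ} (h : lamZero lam < lamOne lam)
    (hs : ∀ k, 2 ≤ k → 0 < (powerSum lam k).re) {nu : Fin n → ℂ}
    (hnu : J (bigN lam) (listPoly lam) = listPoly nu) :
    ∃ σ : Equiv.Perm (Fin n), ∀ i, ‖lam i - nu (σ i)‖ ≤ rootDist lam := by
  obtain ⟨hN1, hN2⟩ := bigN_bounds hn h hs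
  have hB := four_le_bigNBase hn h hs
  have hg := two_le_gam lam
  have hN : (0 : ℝ) < bigN lam := by exact_mod_cast (show 0 < bigN lam by omega)
  refine exists_perm_norm_sub_le (by omega) lam nu (ε := 4 * gam lam ^ n / bigN lam)
    (by positivity) (rootDist_pos hn h hs).le ?_ fun t ht0 ht1 x hx =>
      norm_le_of_segment_root (by positivity) hN1 hN2 (fun i hi => norm_revCoeff_le_gam lam hi)
        (fun i hi => revCoeff_of_J_eq hnu hi) ht0 ht1 hx
  have h1 : rootDist lam / 4 = gam lam / bigNBase lam := by rw [rootDist]; ring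
  have h2 := two_mul_bigNBase_pow_le lam
  rw [h1, div_pow, mul_div_assoc', div_le_div_iff₀ hN (by positivity)]
  have h3 : 0 ≤ gam lam ^ n := by positivity
  nlinarith

/-- Positivity of the power sums of exponent `k ≥ 2` of a conjugation-invariant list that is close
to `lam`. -/
lemma powerSum_pos_of_close (hn : 2 ≤ n) {lam : Fin n → ℂ}
    (hlam0 : ((lam 0).re : ℂ) = lam 0) (h : lamZero lam < lamOne lam)
    (hs : ∀ k, 2 ≤ k → 0 < (powerSum lam k).re) {nu : Fin n → ℂ}
    (hclose : ∀ i, ‖lam i - nu i‖ ≤ rootDist lam)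
    (hconj : ∃ τ : Equiv.Perm (Fin n), ∀ i, starRingEnd ℂ (nu i) = nu (τ i)) {k : ℕ} (hk : 2 ≤ k) :
    0 < (powerSum nu k).re := by
  have hD := rootDist_pos hn h hs
  have hDr := rootDist_le hn h hs
  have hr := smallR_pos h
  have hz0 := lamZero_nonneg lam
  have hclose' (i : Fin n) : ‖nu i - lam i‖ ≤ rootDist lam := by rw [norm_sub_rev]; exact hclose i
  rcases le_or_gt k (NZero lam) with hkN | hkN
  · -- small exponents: compare with the power sum of `lam`
    have hm : lamOne lam ≤ bigm lam := le_max_right _ _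
    have hlam (i : Fin n) : ‖lam i‖ ≤ bigm lam := by
      rcases eq_or_ne i 0 with rfl | hi
      · rw [← hlam0, Complex.norm_real,
          Real.norm_of_nonneg (show 0 ≤ (lam 0).re from hz0.trans h.le)]
        exact hm
      · exact (norm_le_lamZero lam hi).trans (h.le.trans hm)
    have hnu (i : Fin n) : ‖nu i‖ ≤ bigm lam + smallR lam := by
      have := norm_le_norm_add_norm_sub' (nu i) (lam i)
      linarith [hlam i, hclose' i]
    have h1 := norm_powerSum_sub_le hnu (fun i => (hlam i).trans (by linarith)) hclose' k
    have hC := one_le_bigm_add_smallR h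
    have h2 : (n : ℝ) * (k * (bigm lam + smallR lam) ^ (k - 1) * rootDist lam) ≤
        n * (NZero lam * (bigm lam + smallR lam) ^ (NZero lam - 1) * rootDist lam) := by
      gcongr
    have h3 := rootDist_bound hn h hs
    have hM := minM_pos hs
    have h4 : minM lam * smallR lam ≤ minM lam * 1 :=
      mul_le_mul_of_nonneg_left (min_le_right _ _) hM.le
    have h5 := (abs_le.mp ((Complex.abs_re_le_norm _).trans h1)).1
    rw [Complex.sub_re] at h5
    linarith [minM_le_powerSum lam hk hkN]
  · -- large exponents: the first zero dominates
    have hrR : smallR lam ≤ gapR lam := min_le_left _ _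
    rw [gapR] at hrR
    have hsmall (i : Fin n) (hi : i ≠ 0) : ‖nu i‖ ≤ (lamOne lam + 3 * lamZero lam) / 4 := by
      have := norm_le_norm_add_norm_sub' (nu i) (lam i)
      linarith [norm_le_lamZero lam hi, hclose' i]
    have hre : (3 * lamOne lam + lamZero lam) / 4 ≤ (nu 0).re := by
      have := (abs_le.mp ((Complex.abs_re_le_norm _).trans (hclose' 0))).1
      rw [Complex.sub_re] at this
      have h2 : (lam 0).re = lamOne lam := rfl
      linarith
    -- the conjugate of `nu 0` is an entry too large to be one of the others
    have hreal : ((nu 0).re : ℂ) = nu 0 := by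
      obtain ⟨τ, hτ⟩ := hconj
      have h0 : τ 0 = 0 := by
        by_contra hne
        have h1 := hsmall _ hne
        rw [← hτ, Complex.norm_conj] at h1
        linarith [Complex.re_le_norm (nu 0)]
      exact Complex.conj_eq_iff_re.mp (by rw [hτ, h0])
    refine powerSum_re_pos_of_dominant (by linarith) hreal hre hsmall ?_
    have h1 := le_ell_pow hn h hkN.le
    have ha : 0 < lamOne lam + 3 * lamZero lam := by linarith
    have h2 : (3 * lamOne lam + lamZero lam) / 4 =
        ell lam * ((lamOne lam + 3 * lamZero lam) / 4) := by
      rw [ell]; field_simp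
    rw [h2, mul_pow]
    have hn' : (2 : ℝ) ≤ n := by exact_mod_cast hn
    refine mul_lt_mul_of_pos_right (by linarith) (by positivity)

end Constants

end BoyleHandelman

open BoyleHandelman in
/-- The order on `ℂ` is the usual partial one: `z ≤ w` (`z < w`) means that `w - z` is real and
nonnegative (positive). The matrix is the patterned matrix of the power sums of `μ`, and its
spectrum (with multiplicities) is the list `lam` with `N - n` zeros added. -/
theorem mainTheorem1 (n : ℕ) [NeZero n] (hn : 2 ≤ n) (lam : Fin n → ℂ)
    (hPerron : ∀ j : Fin n, j ≠ 0 → ((‖lam j‖ : ℝ) : ℂ) < lam 0)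
    (hs_one : 0 ≤ BoyleHandelman.powerSum lam 1)
    (hs : ∀ k : ℕ, 2 ≤ k → 0 < BoyleHandelman.powerSum lam k) :
    n ≤ BoyleHandelman.bigN lam ∧
    (∃ μ : Fin n → ℂ,
      BoyleHandelman.J (BoyleHandelman.bigN lam) (BoyleHandelman.listPoly lam) =
        ∏ i, (X - C ((BoyleHandelman.bigN lam : ℂ) * μ i))) ∧
    ∀ μ : Fin n → ℂ,
      BoyleHandelman.J (BoyleHandelman.bigN lam) (BoyleHandelman.listPoly lam) =
        ∏ i, (X - C ((BoyleHandelman.bigN lam : ℂ) * μ i)) →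
      (∀ i j, 0 ≤ BoyleHandelman.newtonMatrix (BoyleHandelman.bigN lam)
        (BoyleHandelman.powerSum μ) i j) ∧
      (BoyleHandelman.newtonMatrix (BoyleHandelman.bigN lam)
        (BoyleHandelman.powerSum μ)).charpoly.roots =
        Multiset.map lam Finset.univ.val +
          Multiset.replicate (BoyleHandelman.bigN lam - n) 0 := by
  have hone : (1 : ℕ) < n := hn
  have hP (j : Fin n) (hj : j ≠ 0) : ‖lam j‖ < lamOne lam := (Complex.lt_def.mp (hPerron j hj)).1
  have hlam0 : ((lam 0).re : ℂ) = lam 0 := by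
    have := (Complex.lt_def.mp (hPerron ⟨1, hone⟩ (by simp [Fin.ext_iff]))).2
    rw [Complex.ofReal_im] at this
    exact Complex.ext rfl (by rw [Complex.ofReal_im, ← this])
  have hlt := lamZero_lt_lamOne hn hP
  have hsre (k : ℕ) (hk : 2 ≤ k) : 0 < (powerSum lam k).re := (Complex.lt_def.mp (hs k hk)).1
  have hN := bigN_bounds hn hlt hsre
  have hnN : n ≤ bigN lam := (Nat.le_mul_self n).trans hN.1
  have hN0 : (bigN lam : ℂ) ≠ 0 := by exact_mod_cast (show bigN lam ≠ 0 by omega)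
  refine ⟨hnN, ?_, fun μ hμ => ?_⟩
  · obtain ⟨hm, hd⟩ := J_listPoly_monic (bigN lam) lam
    obtain ⟨z, hz⟩ := exists_listPoly_eq hm hd
    refine ⟨fun i => z i / bigN lam, ?_⟩
    rw [← hz, listPoly]
    simp only [mul_div_cancel₀ _ hN0]
  replace hμ : J (bigN lam) (listPoly lam) = listPoly fun i => (bigN lam : ℂ) * μ i := hμ
  set nu : Fin n → ℂ := fun i => (bigN lam : ℂ) * μ i with hnu
  have hsconj (k : ℕ) (hk : 1 ≤ k) : starRingEnd ℂ (powerSum lam k) = powerSum lam k := by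
    have : 0 ≤ powerSum lam k := by
      rcases eq_or_lt_of_le hk with rfl | hk
      · exact hs_one
      · exact (hs k hk).le
    exact Complex.conj_eq_iff_im.mpr (Complex.le_def.mp this).2.symm
  have hrev (k : ℕ) : starRingEnd ℂ (revCoeff nu k) = revCoeff nu k := by
    rcases Nat.eq_zero_or_pos k with rfl | hk
    · simp [revCoeff_zero]
    rcases le_or_gt k n with hkn | hkn
    · rw [revCoeff_of_J_eq hμ (Finset.mem_Icc.mpr ⟨hk, hkn⟩), map_mul, Complex.conj_ofReal,
        revCoeff_real_of_powerSum_real hsconj]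
    · rw [revCoeff_of_lt nu hkn, map_zero]
  obtain ⟨τ, hτ⟩ := exists_perm_conj hrev
  have him (k : ℕ) : (powerSum nu k).im = 0 := by
    refine Complex.conj_eq_iff_im.mp ?_
    rw [conj_powerSum]
    simp only [hτ]
    exact powerSum_comp_perm nu τ k
  obtain ⟨σ, hσ⟩ := exists_perm_of_J_eq hn hlt hsre hμ
  have hpos (k : ℕ) (hk : 1 ≤ k) : 0 ≤ powerSum nu k := by
    rcases eq_or_lt_of_le hk with rfl | hk
    · have h1 (z : Fin n → ℂ) : powerSum z 1 = -revCoeff z 1 := by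
        have := newton_revCoeff z 0
        simp [revCoeff_zero] at this
        rw [this, neg_neg]
      have h2 := revCoeff_of_J_eq hμ (i := 1) (Finset.mem_Icc.mpr ⟨le_rfl, by omega⟩)
      rw [h1, h2, jFactor]
      rw [h1] at hs_one
      simpa using hs_one
    · refine Complex.le_def.mpr ⟨?_, (him k).symm⟩
      rw [← powerSum_comp_perm nu σ]
      refine (powerSum_pos_of_close hn hlam0 hlt hsre hσ ⟨σ⁻¹ * (τ * σ), fun i => ?_⟩ hk).le
      rw [hτ]
      simp
  constructor
  · have hposμ (k : ℕ) (hk : 1 ≤ k) : 0 ≤ powerSum μ k := by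
      have h1 := hpos k hk
      have h2 : powerSum μ k = (((bigN lam : ℝ) ^ k)⁻¹ : ℝ) * powerSum nu k := by
        rw [hnu, powerSum_mul]
        push_cast
        rw [inv_mul_cancel_left₀ (pow_ne_zero k hN0)]
      rw [h2]
      exact mul_nonneg (Complex.zero_le_real.mpr (by positivity)) h1
    intro i j
    rw [newtonMatrix, Matrix.of_apply]
    split_ifs
    · exact hposμ _ (by omega)
    · exact_mod_cast Nat.zero_le _
    · exact le_rfl
  · rw [charpoly_newtonMatrix_of_J_eq (by omega) hnN hμ, roots_mul, roots_X_pow, roots_listPoly,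
      add_comm, Multiset.nsmul_singleton]
    exact ((monic_X_pow _).mul (listPoly_monic lam)).ne_zero

end
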